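/- Let $A=B=\{0,1\}$, let $\rho_{\max}>0$ and $d\in(0,\rho_{\max}/2)$, and let $\rho(0,0)=\rho(1,1)=0$, $\rho(0,1)=\rho(1,0)=\rho_{\max}$. For a probability distribution $p$ on $A$ and $d'>0$ let $$R(p,d',\rho)=\min\Big\{\sum_{j,k}p(j)W(k|j)\ln\frac{W(k|j)}{Q_W(k)}\ :\ \sum_{j,k}p(j)W(k|j)\rho(j,k)\le d'\Big\},\qquad Q_W(k)=\sum_j p(j)W(k|j),$$ the minimum being over conditional distributions $W$ on $B$ given $A$. A pair $(W^*,\lambda^*)$ with $\lambda^*\in\mathbb R$ is called a Lagrange solution for $p$ if $W^*$ attains the minimum that defines $R(p,d,\rho)$ and, writing $Q=Q_{W^*}$ and $Z(j)=\sum_kQ(k)e^{-\lambda^*\rho(j,k)}$, $$W^*(k|j)=\frac{Q(k)e^{-\lambda^*\rho(j,k)}}{Z(j)},\qquad \sum_j\frac{p(j)}{Z(j)}e^{-\lambda^*\rho(j,k)}\ \begin{cases}=1,&Q(k)>0,\\ \le1,&Q(k)=0,\end{cases}$$ $$\lambda^*\Big(\sum_{j,k}p(j)W^*(k|j)\rho(j,k)-d\Big)=0,\qquad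 R(p,d,\rho)=-\lambda^*d-\sum_jp(j)\ln Z(j),$$ and $-\lambda^*$ is a subgradient of the function $d'\mapsto R(p,d',\rho)$, $d'>0$, at $d'=d$. Let $\mathcal P_{\rho,d}$ be the set of distributions $p$ on $A$ for which a Lagrange solution exists and every Lagrange solution $(W^*,\lambda^*)$ satisfies: 1) the matrix $(e^{-\lambda^*\rho(j,k)})_{j,k}$ has full column rank; 2) $p$ and $Q_{W^*}$ both have full support; 3) $0<\lambda^*<\infty$. A $d$-semifaithful code of block length $n$ consists of a codebook $\mathcal C\subset B^n$, a quantizer $\phi_n:A^n\to\mathcal C$ with $\frac1n\sum_{i=1}^n\rho(x_i,\phi_n(x^n)_i)\le d$ for all $x^n\in A^n$, an encoder $f_n:\mathcal C\to\{0,1\}^*$ and a decoder $g_n:\{0,1\}^*\to\mathcal C$ with $g_n(f_n(y))=y$ for all $y\in\mathcal C$. The encoder need not be prefix-free. Let $l(\cdot)$ be the length of a binary string, and let $\mathbb E_p$ be the expectation for $X^n$ i.i.d. with law $p$. Then $$\liminf_{n\to\infty}\ \inf_{(\phi_n,f_n,g_n)}\ \sup_{p\in\mathcal P_{\rho,d}}\Big[\frac{\ln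 2}{n}\,\mathbb E_p\big[l(f_n(\phi_n(X^n)))\big]-R(p,d,\rho)\Big]\sqrt n\ >\ 0,$$ where the infimum is over all (prefix or non-prefix) $d$-semifaithful codes of block length $n$. -/

import Mathlib

namespace RateDistortion

/-- `W` is a conditional distribution (transition probability matrix) from `A` to `B`:
`W j k` is the probability of `k` given `j`. -/
def IsChannel {A B : Type} [Fintype B] (W : A → B → ℝ) : Prop :=
  ∀ j, W j ∈ stdSimplex ℝ B

/-- The output distribution `k ↦ ∑ j, p j * W j k` on `B`. -/
def outputDist {A B : Type} [Fintype A] (p : A → ℝ) (W : A → B → ℝ) (k : B) : ℝ :=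
  ∑ j, p j * W j k

/-- Mutual information (in nats) of the joint law `p j * W j k`. Terms with `p j * W j k = 0`
vanish, and `outputDist p W k > 0` in all the others. -/
noncomputable def mutualInfo {A B : Type} [Fintype A] [Fintype B]
    (p : A → ℝ) (W : A → B → ℝ) : ℝ :=
  ∑ j, ∑ k, p j * W j k * Real.log (W j k / outputDist p W k)

/-- The expected single-letter distortion of the channel `W` under the source `p`. -/
def expectedDistortion {A B : Type} [Fintype A] [Fintype B]
    (p : A → ℝ) (ρ : A → B → ℝ) (W : A → B → ℝ) : ℝ :=
  ∑ j, ∑ k, p j * W j k * ρ j k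

/-- The channels whose expected distortion is at most `d`. -/
def admissible {A B : Type} [Fintype A] [Fintype B]
    (p : A → ℝ) (d : ℝ) (ρ : A → B → ℝ) : Set (A → B → ℝ) :=
  {W | IsChannel W ∧ expectedDistortion p ρ W ≤ d}

/-- The rate-distortion function `R(p, d, ρ)`, in nats: the least mutual information over the
admissible channels. -/
noncomputable def rate {A B : Type} [Fintype A] [Fintype B]
    (p : A → ℝ) (d : ℝ) (ρ : A → B → ℝ) : ℝ :=
  sInf (mutualInfo p '' admissible p d ρ)

/-- The normalizing factor `∑ k, Q k * exp (-lam * ρ j k)`. -/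
noncomputable def partitionFn {A B : Type} [Fintype B]
    (ρ : A → B → ℝ) (Q : B → ℝ) (lam : ℝ) (j : A) : ℝ :=
  ∑ k, Q k * Real.exp (-lam * ρ j k)

/-- `(W, lam)` solves the Lagrange formulation of the rate-distortion problem for `(p, d, ρ)`. -/
structure IsLagrangeSolution {A B : Type} [Fintype A] [Fintype B]
    (p : A → ℝ) (d : ℝ) (ρ : A → B → ℝ) (W : A → B → ℝ) (lam : ℝ) : Prop where
  /-- `W` is an admissible channel -/
  mem : W ∈ admissible p d ρ
  /-- and attains the minimum. -/
  optimal : mutualInfo p W = rate p d ρ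
  /-- `W` is the exponential tilting of its output distribution. -/
  tilt : ∀ j k, W j k =
    outputDist p W k * Real.exp (-lam * ρ j k) / partitionFn ρ (outputDist p W) lam j
  kkt_eq : ∀ k, 0 < outputDist p W k →
    ∑ j, p j / partitionFn ρ (outputDist p W) lam j * Real.exp (-lam * ρ j k) = 1
  kkt_le : ∀ k, outputDist p W k = 0 →
    ∑ j, p j / partitionFn ρ (outputDist p W) lam j * Real.exp (-lam * ρ j k) ≤ 1
  slack : lam * (expectedDistortion p ρ W - d) = 0
  value : rate p d ρ =
    -lam * d - ∑ j, p j * Real.log (partitionFn ρ (outputDist p W) lam j)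
  /-- `-lam` is a subgradient at `d` of the function `d' ↦ R(p, d', ρ)` on `(0, ∞)`. -/
  subgradient : ∀ d' : ℝ, 0 < d' → rate p d ρ + -lam * (d' - d) ≤ rate p d' ρ

/-- The source distributions that satisfy the three regularity conditions at level `d`. The
conditions speak of "the" Lagrange solution: one exists, and they hold for every one.
The multiplier `lam` is a real number, so it is finite. -/
def regularSources {A B : Type} [Fintype A] [Fintype B]
    (d : ℝ) (ρ : A → B → ℝ) : Set (A → ℝ) :=
  {p | p ∈ stdSimplex ℝ A ∧ (∃ W lam, IsLagrangeSolution p d ρ W lam) ∧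
    ∀ W lam, IsLagrangeSolution p d ρ W lam →
      (Matrix.of fun j k => Real.exp (-lam * ρ j k)).rank = Fintype.card B ∧
      ((∀ j, 0 < p j) ∧ ∀ k, 0 < outputDist p W k) ∧
      0 < lam}

/-- A (deterministic) `d`-semifaithful code of block length `n`: a codebook, a quantizer into it
that meets the distortion level on every source sequence, and a binary encoder/decoder pair for
the codewords. No prefix condition is imposed on the encoder, so the type contains the
prefix and the non-prefix codes. -/
structure SemifaithfulCode {A B : Type} (ρ : A → B → ℝ) (d : ℝ) (n : ℕ) where
  codebook : Set (Fin n → B)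
  quantizer : (Fin n → A) → codebook
  encoder : codebook → List Bool
  decoder : List Bool → codebook
  decoder_encoder : ∀ y, decoder (encoder y) = y
  semifaithful : ∀ x : Fin n → A,
    (∑ i, ρ (x i) ((quantizer x : Fin n → B) i)) / (n : ℝ) ≤ d

/-- The expected length in bits of the encoding of `n` i.i.d. source letters of law `p`. -/
def SemifaithfulCode.expectedLength {A B : Type} [Fintype A] {ρ : A → B → ℝ} {d : ℝ} {n : ℕ}
    (C : SemifaithfulCode ρ d n) (p : A → ℝ) : ℝ :=
  ∑ x : Fin n → A, (∏ i, p (x i)) * ((C.encoder (C.quantizer x)).length : ℝ)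

/-- The rate redundancy of the code `C` under the source `p`, in nats per letter. -/
noncomputable def SemifaithfulCode.redundancy {A B : Type} [Fintype A] [Fintype B]
    {ρ : A → B → ℝ} {d : ℝ} {n : ℕ} (C : SemifaithfulCode ρ d n) (p : A → ℝ) : ℝ :=
  Real.log 2 / (n : ℝ) * C.expectedLength p - rate p d ρ

/-- The scaled Hamming distortion on the binary alphabet. -/
def binaryHamming (ρmax : ℝ) (j k : Fin 2) : ℝ :=
  if j = k then 0 else ρmax

end RateDistortion

open Finset

namespace RateDistortion

/-! Put `δ = d / ρmax`. The redundancy comes from the boundary source `(1 - δ, δ)`, where the binary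
rate formula vanishes but a code still spends order `√n` bits. By `le_binomial_upper_tail`, the
weight of the source word exceeds `n * δ` by a multiple of `√n` with probability bounded below. A
codeword serves only words within distance `n * δ`, and on such words of large weight, recentering
the noise from `0` to the codeword gains a factor exponential in `√n` (`flipProb_zero_le`). Each
binary string therefore accounts for exponentially little of this mass, and the strings of length
below a small multiple of `√n` are too few to cover it (`sum_short_le`). The count uses only
injectivity of the encoder, so prefix-freeness is irrelevant.

The boundary source need not be regular, but the laws `(1 - q, q)` with `δ < q < 1 / 2` are: an
explicit Lagrange solution, certified by duality, yields the rate, and regularity follows. For a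
fixed code the redundancy is continuous in `q`, so letting `q` decrease to `δ` carries the bound
over to the supremum. -/

/-! ### Symmetric noise around a center. -/

/-- The law of a Bernoulli source that emits `1` with probability `q`. -/
def bernoulliLaw (q : ℝ) (j : Fin 2) : ℝ := if j = 0 then 1 - q else q

/-- The probability of `x` when each letter of `y` is flipped independently with probability `δ`. -/
def flipProb (δ : ℝ) {n : ℕ} (y x : Fin n → Fin 2) : ℝ := ∏ i, if x i = y i then 1 - δ else δ

lemma sum_flipProb (δ : ℝ) {n : ℕ} (y : Fin n → Fin 2) : ∑ x, flipProb δ y x = 1 := by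
  unfold flipProb
  have h := Finset.prod_univ_sum (fun _ : Fin n => (univ : Finset (Fin 2)))
    (fun i j => if j = y i then 1 - δ else δ)
  rw [Fintype.piFinset_univ] at h
  rw [← h]
  refine Finset.prod_eq_one fun i _ => ?_
  rw [Fin.sum_univ_two]
  generalize y i = b
  fin_cases b <;> simp

lemma flipProb_nonneg {δ : ℝ} (h0 : 0 < δ) (h1 : δ < 1) {n : ℕ} (y x : Fin n → Fin 2) :
    0 ≤ flipProb δ y x :=
  Finset.prod_nonneg fun i _ => by split_ifs <;> linarith

lemma flipProb_eq {δ : ℝ} (h1 : δ < 1) {n : ℕ} (y x : Fin n → Fin 2) :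
    flipProb δ y x = (1 - δ) ^ n * (δ / (1 - δ)) ^ (hammingDist x y) := by
  have h : ∀ i, (if x i = y i then 1 - δ else δ) =
      (1 - δ) * (if x i ≠ y i then δ / (1 - δ) else 1) := by
    intro i
    have : (1 - δ) ≠ 0 := by linarith
    by_cases h : x i = y i
    · simp [h]
    · simp [h]; field_simp
  unfold flipProb
  simp_rw [h]
  rw [Finset.prod_mul_distrib, Finset.prod_const, Finset.card_univ, Fintype.card_fin,
    Finset.prod_ite, Finset.prod_const, Finset.prod_const_one, mul_one]
  rfl

/-- Far from `0` and close to `y`, the probability of a sequence is exponentially smaller when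
centered at `0` than when centered at `y`. -/
lemma flipProb_zero_le {δ : ℝ} (h0 : 0 < δ) (h2 : δ < 1 / 2) {n : ℕ} (y x : Fin n → Fin 2) {s t : ℝ}
    (hy : (hammingDist x y : ℝ) ≤ s) (hx : s + t ≤ hammingDist x 0) :
    flipProb δ 0 x ≤ (δ / (1 - δ)) ^ t * flipProb δ y x := by
  have hr0 : 0 < δ / (1 - δ) := div_pos h0 (by linarith)
  have hr1 : δ / (1 - δ) ≤ 1 := (div_le_one (by linarith)).2 (by linarith)
  rw [flipProb_eq (by linarith), flipProb_eq (by linarith), mul_left_comm]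
  refine mul_le_mul_of_nonneg_left ?_ (by have : 0 < 1 - δ := by linarith
                                          positivity)
  rw [← Real.rpow_natCast, ← Real.rpow_natCast, ← Real.rpow_add hr0]
  exact Real.rpow_le_rpow_of_exponent_ge hr0 hr1 (by linarith)

/-! ### Central moments and upper tail of the binomial law. -/

/-- The expectation of `f (K - n * δ)` where `K` is binomial with parameters `n` and `δ`. -/
noncomputable def binomialMean (δ : ℝ) (n : ℕ) (f : ℝ → ℝ) : ℝ :=
  ∑ x : Fin n → Fin 2, flipProb δ 0 x * f ((hammingDist x 0 : ℝ) - n * δ)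

/-- Condition on the first letter: it shifts the centered sum by `-δ` or by `1 - δ`. All the moments
follow by induction from this. -/
lemma binomialMean_succ (δ : ℝ) (n : ℕ) (f : ℝ → ℝ) :
    binomialMean δ (n + 1) f =
      (1 - δ) * binomialMean δ n (fun s => f (s - δ)) +
        δ * binomialMean δ n (fun s => f (s + (1 - δ))) := by
  have hd : ∀ (m : ℕ) (x : Fin m → Fin 2), (hammingDist x 0 : ℝ) = ∑ i, if x i = 0 then 0 else 1 := by
    intro m x
    simp [hammingDist, Finset.card_filter]
  unfold binomialMean
  rw [← (Fin.consEquiv fun _ => Fin 2).sum_comp, Fintype.sum_prod_type, Fin.sum_univ_two,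
    Finset.mul_sum, Finset.mul_sum]
  congr 1 <;> refine Finset.sum_congr rfl fun x _ => ?_
  · rw [hd, hd]
    simp only [flipProb, Fin.prod_univ_succ, Fin.sum_univ_succ, Fin.consEquiv_apply, Fin.cons_zero,
      Fin.cons_succ, Pi.zero_apply, if_true, mul_assoc]
    push_cast
    ring_nf
  · rw [hd, hd]
    simp only [flipProb, Fin.prod_univ_succ, Fin.sum_univ_succ, Fin.consEquiv_apply, Fin.cons_zero,
      Fin.cons_succ, Pi.zero_apply, one_ne_zero, if_false, mul_assoc]
    push_cast
    ring_nf

lemma binomialMean_add (δ : ℝ) (n : ℕ) (f g : ℝ → ℝ) :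
    binomialMean δ n (fun s => f s + g s) = binomialMean δ n f + binomialMean δ n g := by
  simp [binomialMean, mul_add, Finset.sum_add_distrib]

lemma binomialMean_const_mul (δ : ℝ) (n : ℕ) (c : ℝ) (f : ℝ → ℝ) :
    binomialMean δ n (fun s => c * f s) = c * binomialMean δ n f := by
  simp [binomialMean, Finset.mul_sum, mul_left_comm]

lemma binomialMean_const (δ : ℝ) (n : ℕ) (c : ℝ) : binomialMean δ n (fun _ => c) = c := by
  simp [binomialMean, ← Finset.sum_mul, sum_flipProb]

lemma binomialMean_id (δ : ℝ) (n : ℕ) : binomialMean δ n (fun s => s) = 0 := by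
  induction n with
  | zero => simp [binomialMean, hammingDist]
  | succ n ih =>
    rw [binomialMean_succ]
    simp only [sub_eq_add_neg, binomialMean_add, binomialMean_const, ih]
    ring

lemma binomialMean_const_mul_id (δ : ℝ) (n : ℕ) (c : ℝ) : binomialMean δ n (fun s => c * s) = 0 := by
  rw [binomialMean_const_mul, binomialMean_id, mul_zero]

lemma binomialMean_sq (δ : ℝ) (n : ℕ) : binomialMean δ n (fun s => s ^ 2) = n * (δ * (1 - δ)) := by
  induction n with
  | zero => simp [binomialMean, hammingDist]
  | succ n ih =>
    have h : ∀ a : ℝ, binomialMean δ n (fun s => (s + a) ^ 2) = n * (δ * (1 - δ)) + a ^ 2 := by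
      intro a
      have : (fun s : ℝ => (s + a) ^ 2) = fun s => s ^ 2 + (2 * a * s + a ^ 2) := by
        ext s; ring
      rw [this]
      simp only [binomialMean_add, binomialMean_const_mul_id, binomialMean_const, ih]
      ring
    rw [binomialMean_succ]
    simp only [sub_eq_add_neg _ δ, h]
    push_cast
    ring

/-- The third-moment terms cancel in the recursion because the two shifts average to zero. -/
lemma binomialMean_pow_four_le {δ : ℝ} (h0 : 0 < δ) (h1 : δ < 1) (n : ℕ) :
    binomialMean δ n (fun s => s ^ 4) ≤ 3 * (n * (δ * (1 - δ))) ^ 2 + n * (δ * (1 - δ)) := by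
  induction n with
  | zero => simp [binomialMean, hammingDist]
  | succ n ih =>
    have h : ∀ a : ℝ, binomialMean δ n (fun s => (s + a) ^ 4) =
        binomialMean δ n (fun s => s ^ 4) + 4 * a * binomialMean δ n (fun s => s ^ 3) +
          6 * a ^ 2 * (n * (δ * (1 - δ))) + a ^ 4 := by
      intro a
      have : (fun s : ℝ => (s + a) ^ 4) =
          fun s => s ^ 4 + (4 * a * s ^ 3 + (6 * a ^ 2 * s ^ 2 + (4 * a ^ 3 * s + a ^ 4))) := by
        ext s; ring
      rw [this]
      simp only [binomialMean_add, binomialMean_const_mul_id, binomialMean_const_mul, binomialMean_const,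
        binomialMean_sq]
      ring
    have hs : binomialMean δ n (fun s => (s - δ) ^ 4) = _ := h (-δ)
    rw [binomialMean_succ, h, hs]
    push_cast
    have hv : 0 < δ * (1 - δ) := mul_pos h0 (by linarith)
    nlinarith [mul_pos hv hv, mul_pos hv (mul_pos hv hv)]

lemma binomialMean_mono {δ : ℝ} (h0 : 0 < δ) (h1 : δ < 1) (n : ℕ) {f g : ℝ → ℝ}
    (h : ∀ s, f s ≤ g s) : binomialMean δ n f ≤ binomialMean δ n g :=
  Finset.sum_le_sum fun x _ => mul_le_mul_of_nonneg_left (h _) (flipProb_nonneg h0 h1 0 x)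

/-- A binomial variable exceeds its mean by a multiple of its standard deviation with a probability
bounded below. -/
lemma le_binomial_upper_tail {δ : ℝ} (h0 : 0 < δ) (h1 : δ < 1) {n : ℕ} (hn : 0 < n) :
    δ * (1 - δ) / 16 ≤ ∑ x : Fin n → Fin 2 with
      n * δ + δ * (1 - δ) / 32 * √n ≤ (hammingDist x 0 : ℝ), flipProb δ 0 x := by
  set v := δ * (1 - δ) with hv
  have hv0 : 0 < v := mul_pos h0 (by linarith)
  have hv4 : v ≤ 1 / 4 := by nlinarith [sq_nonneg (δ - 1 / 2)]
  have hn1 : (1 : ℝ) ≤ n := by exact_mod_cast hn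
  have hn0 : (0 : ℝ) < n := by linarith
  have hs0 : 0 < √(n : ℝ) := Real.sqrt_pos.2 hn0
  have hs2 : √(n : ℝ) ^ 2 = n := Real.sq_sqrt hn0.le
  set b := (√(n : ℝ))⁻¹ with hb
  have hb0 : 0 < b := inv_pos.2 hs0
  have hbs : b * √(n : ℝ) = 1 := inv_mul_cancel₀ hs0.ne'
  have hb2 : b ^ 2 * n = 1 := by rw [← hs2, ← mul_pow, hbs, one_pow]
  -- A quartic minorant of twice the indicator, to be used at `t = s / √n`. The mean-zero linear
  -- term makes it negative on the left. With `v ≤ 1 / 4`, its expectation is at least `3v/8 - (3v²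
  -- + v)/8 - v/32 ≥ v/8`.
  have key : ∀ t : ℝ, 1 / 2 * t + (3 / 8 * t ^ 2 + (-(1 / 8) * t ^ 4 + -(v / 32))) ≤
      2 * (if v / 32 ≤ t then 1 else 0) := by
    intro t
    split_ifs with h
    · nlinarith [sq_nonneg (t ^ 2 - 2), sq_nonneg (t - 1), sq_nonneg (t - 2)]
    · push Not at h
      rcases le_or_gt 0 t with ht | ht
      · have : t ≤ 1 := by linarith
        nlinarith [pow_nonneg ht 4, mul_nonneg ht (sub_nonneg.2 this)]
      · nlinarith [sq_nonneg (t ^ 2 + t), sq_nonneg (t + 1), sq_nonneg (t ^ 2 - 1), sq_nonneg t]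
  have hm := binomialMean_mono h0 h1 n fun s => key (b * s)
  have hexp : (fun s : ℝ => 1 / 2 * (b * s) + (3 / 8 * (b * s) ^ 2 +
      (-(1 / 8) * (b * s) ^ 4 + -(v / 32)))) = fun s : ℝ => 1 / 2 * b * s + (3 / 8 * b ^ 2 * s ^ 2 +
      (-(1 / 8) * b ^ 4 * s ^ 4 + -(v / 32))) := by ext s; ring
  rw [hexp] at hm
  simp only [binomialMean_add, binomialMean_const_mul_id, binomialMean_const_mul, binomialMean_const,
        binomialMean_sq] at hm
  have h4 := mul_le_mul_of_nonneg_left (binomialMean_pow_four_le h0 h1 n) (pow_nonneg hb0.le 4)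
  rw [← hv] at h4 hm
  have hb4 : b ^ 4 * (3 * (n * v) ^ 2 + n * v) = 3 * v ^ 2 + b ^ 2 * v := by
    linear_combination (3 * v ^ 2 * (b ^ 2 * n + 1) + b ^ 2 * v) * hb2
  have hb1 : b ^ 2 ≤ 1 := by nlinarith [sq_nonneg b]
  have hlow : v / 8 ≤ 2 * binomialMean δ n (fun s => if v / 32 ≤ b * s then 1 else 0) := by
    nlinarith [mul_le_mul_of_nonneg_right hb1 hv0.le]
  have heq : binomialMean δ n (fun s => if v / 32 ≤ b * s then 1 else 0) =
      ∑ x : Fin n → Fin 2 with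
        n * δ + v / 32 * √n ≤ (hammingDist x 0 : ℝ), flipProb δ 0 x := by
    rw [binomialMean, Finset.sum_filter]
    refine Finset.sum_congr rfl fun x _ => ?_
    rw [mul_ite, mul_one, mul_zero]
    refine if_congr ?_ rfl rfl
    rw [hb, inv_mul_eq_div, le_div_iff₀ hs0]
    constructor <;> intro h <;> linarith
  linarith

/-! ### Length lower bound at the boundary source. -/

/-- The binary strings of length at most `m`. -/
def shortStrings (m : ℕ) : Finset (List Bool) :=
  (Finset.range (m + 1)).biUnion fun i => (univ : Finset (Fin i → Bool)).image List.ofFn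

lemma mem_shortStrings {m : ℕ} {s : List Bool} (h : s.length ≤ m) : s ∈ shortStrings m := by
  simp only [shortStrings, Finset.mem_biUnion, Finset.mem_range, Finset.mem_image, Finset.mem_univ,
    true_and]
  exact ⟨s.length, by omega, s.get, List.ofFn_get s⟩

lemma card_shortStrings_le (m : ℕ) : #(shortStrings m) ≤ 2 ^ (m + 1) := by
  refine Finset.card_biUnion_le.trans ?_
  calc ∑ i ∈ Finset.range (m + 1), #((univ : Finset (Fin i → Bool)).image List.ofFn)
      ≤ ∑ i ∈ Finset.range (m + 1), 2 ^ i :=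
        Finset.sum_le_sum fun i _ => Finset.card_image_le.trans (by simp)
    _ ≤ 2 ^ (m + 1) := by
        rw [Nat.geomSum_eq le_rfl]
        simp

variable {ρmax d : ℝ} {n : ℕ}

lemma SemifaithfulCode.hammingDist_le (hρ : 0 < ρmax) (hn : 0 < n)
    (C : SemifaithfulCode (binaryHamming ρmax) d n) (x : Fin n → Fin 2) :
    (hammingDist x (C.quantizer x : Fin n → Fin 2) : ℝ) ≤ n * (d / ρmax) := by
  have h := C.semifaithful x
  have hn0 : (0 : ℝ) < n := by exact_mod_cast hn
  have he : ∑ i, binaryHamming ρmax (x i) ((C.quantizer x : Fin n → Fin 2) i) =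
      hammingDist x (C.quantizer x : Fin n → Fin 2) * ρmax := by
    simp only [binaryHamming, hammingDist, Finset.card_filter]
    push_cast
    rw [Finset.sum_mul]
    refine Finset.sum_congr rfl fun i _ => ?_
    by_cases h : x i = (C.quantizer x : Fin n → Fin 2) i <;> simp [h]
  rw [he, div_le_iff₀ hn0] at h
  rw [← mul_div_assoc, le_div_iff₀ hρ]
  linarith

/-- Few sequences far from `0` have a short description. -/
lemma SemifaithfulCode.sum_short_le (hρ : 0 < ρmax) (hd : 0 < d) (hd2 : d < ρmax / 2) (hn : 0 < n)
    (C : SemifaithfulCode (binaryHamming ρmax) d n) (t : ℝ) (m : ℕ) :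
    ∑ x : Fin n → Fin 2 with n * (d / ρmax) + t ≤ (hammingDist x 0 : ℝ) ∧
        (C.encoder (C.quantizer x)).length ≤ m, flipProb (d / ρmax) 0 x ≤
      2 ^ (m + 1) * (d / ρmax / (1 - d / ρmax)) ^ t := by
  have h0 : 0 < d / ρmax := div_pos hd hρ
  have h2 : d / ρmax < 1 / 2 := by rw [div_lt_iff₀ hρ]; linarith
  set δ := d / ρmax
  have hr : 0 < δ / (1 - δ) := div_pos h0 (by linarith)
  rw [← Finset.sum_fiberwise_of_maps_to (t := shortStrings m)
    (g := fun x => C.encoder (C.quantizer x))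
    (fun x hx => mem_shortStrings (Finset.mem_filter.1 hx).2.2)]
  -- The words described by `s` lie within `n * δ` of `decoder s`; recentering there gains the
  -- factor, and the recentered law has total mass one.
  have hfib : ∀ s ∈ shortStrings m, ∑ x ∈ (univ.filter fun x : Fin n → Fin 2 =>
      n * δ + t ≤ (hammingDist x 0 : ℝ) ∧ (C.encoder (C.quantizer x)).length ≤ m) with
        C.encoder (C.quantizer x) = s, flipProb δ 0 x ≤ (δ / (1 - δ)) ^ t := by
    intro s _
    calc _ ≤ ∑ x ∈ (univ.filter fun x : Fin n → Fin 2 =>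
      n * δ + t ≤ (hammingDist x 0 : ℝ) ∧ (C.encoder (C.quantizer x)).length ≤ m) with
        C.encoder (C.quantizer x) = s,
          (δ / (1 - δ)) ^ t * flipProb δ (C.decoder s : Fin n → Fin 2) x := by
          refine Finset.sum_le_sum fun x hx => ?_
          rw [Finset.mem_filter, Finset.mem_filter] at hx
          refine flipProb_zero_le h0 h2 _ x (s := n * δ) ?_ hx.1.2.1
          rw [← hx.2, C.decoder_encoder]
          exact C.hammingDist_le hρ hn x
      _ ≤ ∑ x, (δ / (1 - δ)) ^ t * flipProb δ (C.decoder s : Fin n → Fin 2) x :=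
          Finset.sum_le_sum_of_subset_of_nonneg (Finset.subset_univ _) fun x _ _ =>
            mul_nonneg (Real.rpow_nonneg hr.le _) (flipProb_nonneg h0 (by linarith) _ _)
      _ = (δ / (1 - δ)) ^ t := by rw [← Finset.mul_sum, sum_flipProb, mul_one]
  refine (Finset.sum_le_card_nsmul _ _ _ hfib).trans ?_
  rw [nsmul_eq_mul]
  refine mul_le_mul_of_nonneg_right ?_ (Real.rpow_nonneg hr.le _)
  exact_mod_cast card_shortStrings_le m

/-- At the source of law `(1 - d / ρmax, d / ρmax)`, whose rate vanishes, the expected length is at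
least of the order of `√n`. -/
lemma SemifaithfulCode.eventually_le_expectedLength (hρ : 0 < ρmax) (hd : 0 < d)
    (hd2 : d < ρmax / 2) :
    ∃ c > 0, ∀ᶠ n : ℕ in Filter.atTop, ∀ C : SemifaithfulCode (binaryHamming ρmax) d n,
      c * √n ≤ C.expectedLength (bernoulliLaw (d / ρmax)) := by
  have h0 : 0 < d / ρmax := div_pos hd hρ
  have h2 : d / ρmax < 1 / 2 := by rw [div_lt_iff₀ hρ]; linarith
  have htail := fun n hn => le_binomial_upper_tail (δ := d / ρmax) (n := n) h0 (by linarith) hn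
  have hshort := fun n hn C t m => SemifaithfulCode.sum_short_le (n := n) hρ hd hd2 hn C t m
  set δ := d / ρmax with hδ
  set v := δ * (1 - δ) with hv
  have hv0 : 0 < v := mul_pos h0 (by linarith)
  have hr : 0 < δ / (1 - δ) := div_pos h0 (by linarith)
  have hr1 : δ / (1 - δ) < 1 := (div_lt_one (by linarith)).2 (by linarith)
  set r := δ / (1 - δ) with hr_def
  have hlog : Real.log r < 0 := Real.log_neg hr hr1
  -- Half the decay exponent: `r ^ (v / 32 * √n) = exp (-2c√n)`, while the choice of `m` below keeps
  -- `2 ^ m ≤ exp (c√n)`.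
  set c := v / 32 * -Real.log r / 2 with hc
  have hc0 : 0 < c := by have : 0 < -Real.log r := by linarith
                         positivity
  have hl2 : 0 < Real.log 2 := Real.log_pos one_lt_two
  have hlim : Filter.Tendsto (fun n : ℕ => 2 * Real.exp (-(c * √(n : ℝ)))) Filter.atTop
      (nhds (2 * 0)) := by
    refine Filter.Tendsto.const_mul _ (Real.tendsto_exp_neg_atTop_nhds_zero.comp ?_)
    exact Filter.Tendsto.const_mul_atTop hc0
      (Real.tendsto_sqrt_atTop.comp tendsto_natCast_atTop_atTop)
  rw [mul_zero] at hlim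
  refine ⟨v / 32 * (c / Real.log 2), by positivity, ?_⟩
  filter_upwards [hlim.eventually (ge_mem_nhds (show 0 < v / 32 by positivity)),
    Filter.eventually_gt_atTop 0] with n hsmall hn C
  have hs0 : 0 ≤ √(n : ℝ) := Real.sqrt_nonneg _
  have hx0 : 0 ≤ c / Real.log 2 * √n := by positivity
  set m := ⌊c / Real.log 2 * √n⌋₊ with hm
  have hmle : (m : ℝ) ≤ c / Real.log 2 * √n := Nat.floor_le hx0
  have hmlt : c / Real.log 2 * √n < m + 1 := Nat.lt_floor_add_one _
  have hsh := hshort n hn C (v / 32 * √n) m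
  have hbound : (2 : ℝ) ^ (m + 1) * r ^ (v / 32 * √n) ≤ 2 * Real.exp (-(c * √(n : ℝ))) := by
    rw [pow_succ', mul_assoc]
    refine mul_le_mul_of_nonneg_left ?_ zero_le_two
    rw [Real.rpow_def_of_pos hr, ← Real.rpow_natCast, Real.rpow_def_of_pos two_pos, ← Real.exp_add]
    refine Real.exp_le_exp.2 ?_
    have := mul_le_mul_of_nonneg_left hmle hl2.le
    rw [← mul_assoc, mul_div_cancel₀ _ hl2.ne'] at this
    rw [hc] at this ⊢
    linarith
  have hsplit := Finset.sum_filter_add_sum_filter_not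
    (univ.filter fun x : Fin n → Fin 2 => n * δ + v / 32 * √n ≤ (hammingDist x 0 : ℝ))
    (fun x => (C.encoder (C.quantizer x)).length ≤ m) (flipProb δ 0)
  rw [Finset.filter_filter, Finset.filter_filter] at hsplit
  -- Of the tail mass `v / 16`, the short descriptions take at most `v / 32` for large `n`.
  have hlong : v / 32 ≤ ∑ x : Fin n → Fin 2 with n * δ + v / 32 * √n ≤ (hammingDist x 0 : ℝ) ∧
      ¬ (C.encoder (C.quantizer x)).length ≤ m, flipProb δ 0 x := by
    have := htail n hn
    linarith
  calc v / 32 * (c / Real.log 2) * √n = v / 32 * (c / Real.log 2 * √n) := by ring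
    _ ≤ (∑ x : Fin n → Fin 2 with n * δ + v / 32 * √n ≤ (hammingDist x 0 : ℝ) ∧
      ¬ (C.encoder (C.quantizer x)).length ≤ m, flipProb δ 0 x) * (c / Real.log 2 * √n) :=
        mul_le_mul_of_nonneg_right hlong hx0
    _ = ∑ x : Fin n → Fin 2 with n * δ + v / 32 * √n ≤ (hammingDist x 0 : ℝ) ∧
      ¬ (C.encoder (C.quantizer x)).length ≤ m, flipProb δ 0 x * (c / Real.log 2 * √n) :=
        Finset.sum_mul _ _ _
    _ ≤ ∑ x : Fin n → Fin 2 with n * δ + v / 32 * √n ≤ (hammingDist x 0 : ℝ) ∧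
      ¬ (C.encoder (C.quantizer x)).length ≤ m,
        flipProb δ 0 x * ((C.encoder (C.quantizer x)).length : ℝ) := by
        refine Finset.sum_le_sum fun x hx => mul_le_mul_of_nonneg_left ?_
          (flipProb_nonneg h0 (by linarith) _ _)
        have h := (Finset.mem_filter.1 hx).2.2
        have : m + 1 ≤ (C.encoder (C.quantizer x)).length := by omega
        have : (m : ℝ) + 1 ≤ ((C.encoder (C.quantizer x)).length : ℝ) := by exact_mod_cast this
        linarith
    _ ≤ C.expectedLength (bernoulliLaw δ) := by
        -- `flipProb δ 0 x` unfolds to the product of the `bernoulliLaw δ (x i)`.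
        refine Finset.sum_le_sum_of_subset_of_nonneg (Finset.subset_univ _) fun x _ _ => ?_
        exact mul_nonneg (flipProb_nonneg h0 (by linarith) _ _) (Nat.cast_nonneg _)


/-! ### Duality and the binary Lagrange solution. -/

/-- The dual lower bound for the mutual information. -/
lemma dual_le_mutualInfo {A B : Type} [Fintype A] [Fintype B] {p : A → ℝ} (hp : p ∈ stdSimplex ℝ A)
    {ρ W : A → B → ℝ} {lam d : ℝ} (hlam : 0 ≤ lam) {Z : A → ℝ} (hZ : ∀ j, 0 < Z j)
    (hk : ∀ k, ∑ j, p j / Z j * Real.exp (-lam * ρ j k) ≤ 1) (hW : W ∈ admissible p d ρ) :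
    -lam * d - ∑ j, p j * Real.log (Z j) ≤ mutualInfo p W := by
  obtain ⟨hW, hD⟩ := hW
  have hpW : ∀ j k, 0 ≤ p j * W j k := fun j k => mul_nonneg (hp.1 j) ((hW j).1 k)
  have hQ : ∀ k, 0 ≤ outputDist p W k := fun k => Finset.sum_nonneg fun j _ => hpW j k
  have hsum : ∀ f : A → ℝ, ∑ j, ∑ k, p j * W j k * f j = ∑ j, p j * f j := by
    intro f
    refine Finset.sum_congr rfl fun j _ => ?_
    rw [← Finset.sum_mul, ← Finset.mul_sum, (hW j).2, mul_one]
  have hterm : ∀ j k, -lam * (p j * W j k * ρ j k) - p j * W j k * Real.log (Z j) + p j * W j k -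
      outputDist p W k * (p j / Z j * Real.exp (-lam * ρ j k)) ≤
      p j * W j k * Real.log (W j k / outputDist p W k) := by
    intro j k
    rcases (hpW j k).eq_or_lt with h | h
    · rw [← h]
      have : 0 ≤ outputDist p W k * (p j / Z j * Real.exp (-lam * ρ j k)) :=
        mul_nonneg (hQ k) (mul_nonneg (div_nonneg (hp.1 j) (hZ j).le) (Real.exp_pos _).le)
      simpa using this
    · have hq : 0 < outputDist p W k :=
        h.trans_le (Finset.single_le_sum (fun i _ => hpW i k) (Finset.mem_univ j))
      have hw : 0 < W j k := ((hW j).1 k).lt_of_ne' fun h' => by simp [h'] at h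
      have hz := hZ j
      have hx : 0 < W j k / outputDist p W k * Z j * Real.exp (lam * ρ j k) := by positivity
      -- The bound `1 - 1/x ≤ log x` is applied to the ratio of `W j k` to the tilting of its own
      -- output law by `lam` and `Z`.
      have hl := Real.one_sub_inv_le_log_of_pos hx
      rw [Real.log_mul (by positivity) (by positivity), Real.log_mul (by positivity) hz.ne',
        Real.log_exp] at hl
      have hi : (W j k / outputDist p W k * Z j * Real.exp (lam * ρ j k))⁻¹ =
          outputDist p W k / (W j k * Z j) * Real.exp (-lam * ρ j k) := by
        rw [neg_mul, Real.exp_neg]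
        field_simp
      rw [hi] at hl
      have hm := mul_le_mul_of_nonneg_left hl h.le
      have he : p j * W j k * (1 - outputDist p W k / (W j k * Z j) * Real.exp (-lam * ρ j k)) =
          p j * W j k - outputDist p W k * (p j / Z j * Real.exp (-lam * ρ j k)) := by
        field_simp
      rw [he] at hm
      linarith
  have h1 : ∑ j, ∑ k, p j * W j k = 1 := by
    have := hsum fun _ => 1
    simpa [hp.2] using this
  have hQ1 : ∑ k, outputDist p W k = 1 := by
    unfold outputDist
    rw [Finset.sum_comm, h1]
  have hQk : ∑ j, ∑ k, outputDist p W k * (p j / Z j * Real.exp (-lam * ρ j k)) ≤ 1 := by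
    rw [Finset.sum_comm, ← hQ1]
    refine Finset.sum_le_sum fun k _ => ?_
    rw [← Finset.mul_sum]
    exact mul_le_of_le_one_right (hQ k) (hk k)
  have htot := Finset.sum_le_sum fun j (_ : j ∈ univ) =>
    Finset.sum_le_sum fun k (_ : k ∈ univ) => hterm j k
  simp only [Finset.sum_sub_distrib, Finset.sum_add_distrib, ← Finset.mul_sum] at htot
  have hZs := hsum fun j => Real.log (Z j)
  simp only [← Finset.mul_sum] at h1
  have hDs := mul_le_mul_of_nonneg_left hD hlam
  unfold expectedDistortion at hDs
  unfold mutualInfo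
  linarith

lemma bernoulliLaw_mem {q : ℝ} (h0 : 0 ≤ q) (h1 : q ≤ 1) : bernoulliLaw q ∈ stdSimplex ℝ (Fin 2) := by
  refine ⟨fun j => ?_, ?_⟩
  · unfold bernoulliLaw
    split_ifs <;> linarith
  · simp [bernoulliLaw]

/-- The slope of the binary rate-distortion function. -/
noncomputable def binaryMultiplier (ρmax d : ℝ) : ℝ :=
  Real.log ((1 - d / ρmax) / (d / ρmax)) / ρmax

/-- The value of the binary rate-distortion function at `(1 - q, q)` when positive. -/
noncomputable def binaryRate (ρmax d q : ℝ) : ℝ :=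
  -binaryMultiplier ρmax d * d -
    ((1 - q) * Real.log ((1 - q) / (1 - d / ρmax)) + q * Real.log (q / (1 - d / ρmax)))

lemma binaryMultiplier_pos {ρmax d : ℝ} (hd : 0 < d) (hd2 : d < ρmax / 2) :
    0 < binaryMultiplier ρmax d := by
  have hρ : 0 < ρmax := by linarith
  have h0 : 0 < d / ρmax := div_pos hd hρ
  have h2 : d / ρmax < 1 / 2 := by rw [div_lt_iff₀ hρ]; linarith
  exact div_pos (Real.log_pos ((one_lt_div h0).2 (by linarith))) hρ

lemma exp_binaryMultiplier {ρmax d : ℝ} (hd : 0 < d) (hd2 : d < ρmax / 2) :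
    Real.exp (-binaryMultiplier ρmax d * ρmax) = d / ρmax / (1 - d / ρmax) := by
  have hρ : 0 < ρmax := by linarith
  have h0 : 0 < d / ρmax := div_pos hd hρ
  have h2 : d / ρmax < 1 / 2 := by rw [div_lt_iff₀ hρ]; linarith
  rw [binaryMultiplier, neg_mul, div_mul_cancel₀ _ hρ.ne', Real.exp_neg, Real.exp_log, inv_div]
  exact div_pos (by linarith) h0

lemma binaryRate_self {ρmax d : ℝ} (hd : 0 < d) (hd2 : d < ρmax / 2) :
    binaryRate ρmax d (d / ρmax) = 0 := by
  have hρ : 0 < ρmax := by linarith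
  have h0 : 0 < d / ρmax := div_pos hd hρ
  have h2 : d / ρmax < 1 / 2 := by rw [div_lt_iff₀ hρ]; linarith
  have h1 : 0 < 1 - d / ρmax := by linarith
  have hlog : Real.log (d / ρmax / (1 - d / ρmax)) = -Real.log ((1 - d / ρmax) / (d / ρmax)) := by
    rw [← Real.log_inv, inv_div]
  rw [binaryRate, binaryMultiplier, div_self h1.ne', Real.log_one, hlog]
  ring

/-- The explicit Lagrange solution of the binary Hamming problem. -/
lemma exists_isLagrangeSolution {ρmax d q : ℝ} (hd : 0 < d) (hdq : d < q * ρmax) (hρ : 0 < ρmax)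
    (hq : q < 1 / 2) :
    ∃ W, IsLagrangeSolution (bernoulliLaw q) d (binaryHamming ρmax) W (binaryMultiplier ρmax d) ∧
      rate (bernoulliLaw q) d (binaryHamming ρmax) = binaryRate ρmax d q := by
  have hd2 : d < ρmax / 2 := by nlinarith
  have h0 : 0 < d / ρmax := div_pos hd hρ
  have h2 : d / ρmax < q := by rwa [div_lt_iff₀ hρ]
  have hlam := binaryMultiplier_pos hd hd2
  have hexp := exp_binaryMultiplier hd hd2
  have hrate : binaryRate ρmax d q = -binaryMultiplier ρmax d * d -
    ((1 - q) * Real.log ((1 - q) / (1 - d / ρmax)) + q * Real.log (q / (1 - d / ρmax))) := rfl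
  have hdδ : d = d / ρmax * ρmax := (div_mul_cancel₀ _ hρ.ne').symm
  set lam := binaryMultiplier ρmax d with hlam_def
  set δ := d / ρmax with hδ
  have h1 : 0 < 1 - δ := by linarith
  have h12 : 0 < 1 - 2 * δ := by linarith
  have h12' : 1 - δ * 2 ≠ 0 := by linarith
  have hq0 : 0 < q := by linarith
  have hq1 : 0 < 1 - q := by linarith
  have hp := bernoulliLaw_mem hq0.le (by linarith : q ≤ 1)
  set p := bernoulliLaw q with hp_def
  have hp0 : p 0 = 1 - q := rfl
  have hp1 : p 1 = q := rfl
  set ρ := binaryHamming ρmax with hρ_def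
  have hρ00 : ρ 0 0 = 0 := rfl
  have hρ01 : ρ 0 1 = ρmax := rfl
  have hρ10 : ρ 1 0 = ρmax := rfl
  have hρ11 : ρ 1 1 = 0 := rfl
  -- The output law that symmetric noise of level `δ` turns into `p`; it is positive at `1` exactly
  -- because `δ < q`.
  let Q : Fin 2 → ℝ := fun k => if k = 0 then (1 - q - δ) / (1 - 2 * δ) else (q - δ) / (1 - 2 * δ)
  have hQ0 : Q 0 = (1 - q - δ) / (1 - 2 * δ) := rfl
  have hQ1 : Q 1 = (q - δ) / (1 - 2 * δ) := rfl
  have hQ0p : 0 < Q 0 := by rw [hQ0]; exact div_pos (by linarith) h12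
  have hQ1p : 0 < Q 1 := by rw [hQ1]; exact div_pos (by linarith) h12
  have hZ0 : partitionFn ρ Q lam 0 = p 0 / (1 - δ) := by
    simp only [partitionFn, Fin.sum_univ_two, hρ00, hρ01, mul_zero, Real.exp_zero, hexp, hQ0, hQ1, hp0]
    field_simp
    ring
  have hZ1 : partitionFn ρ Q lam 1 = p 1 / (1 - δ) := by
    simp only [partitionFn, Fin.sum_univ_two, hρ10, hρ11, mul_zero, Real.exp_zero, hexp, hQ0, hQ1, hp1]
    field_simp
    ring
  have hZ : ∀ j, 0 < partitionFn ρ Q lam j := by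
    rw [Fin.forall_fin_two, hZ0, hZ1, hp0, hp1]
    exact ⟨div_pos hq1 h1, div_pos hq0 h1⟩
  let W : Fin 2 → Fin 2 → ℝ := fun j k => Q k * Real.exp (-lam * ρ j k) / partitionFn ρ Q lam j
  have hW : ∀ j k, W j k = Q k * Real.exp (-lam * ρ j k) / partitionFn ρ Q lam j := fun _ _ => rfl
  have hkkt : ∀ k, ∑ j, p j / partitionFn ρ Q lam j * Real.exp (-lam * ρ j k) = 1 := by
    rw [Fin.forall_fin_two]
    simp only [Fin.sum_univ_two, hZ0, hZ1, hρ00, hρ01, hρ10, hρ11, hexp, mul_zero, Real.exp_zero, hp0,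
      hp1]
    constructor <;> field_simp <;> ring
  have hout : outputDist p W = Q := by
    ext k
    calc outputDist p W k = Q k * ∑ j, p j / partitionFn ρ Q lam j * Real.exp (-lam * ρ j k) := by
          rw [outputDist, Finset.mul_sum]
          refine Finset.sum_congr rfl fun j _ => ?_
          rw [hW]
          ring
      _ = Q k := by rw [hkkt, mul_one]
  have hQn : ∀ k, 0 < Q k := by
    rw [Fin.forall_fin_two]
    exact ⟨hQ0p, hQ1p⟩
  have hch : IsChannel W := by
    intro j
    refine ⟨fun k => div_nonneg (mul_nonneg (hQn k).le (Real.exp_pos _).le) (hZ j).le, ?_⟩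
    simp only [hW]
    rw [← Finset.sum_div]
    exact div_self (hZ j).ne'
  have hD : expectedDistortion p ρ W = d := by
    simp only [expectedDistortion, Fin.sum_univ_two, hW, hZ0, hZ1, hρ00, hρ01, hρ10, hρ11, hexp,
      mul_zero, Real.exp_zero, hp0, hp1, hQ0, hQ1]
    rw [hdδ]
    field_simp
    ring
  have hadm : W ∈ admissible p d ρ := ⟨hch, hD.le⟩
  have hsumZ : ∑ j, p j * Real.log (partitionFn ρ Q lam j) =
      (1 - q) * Real.log ((1 - q) / (1 - δ)) + q * Real.log (q / (1 - δ)) := by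
    rw [Fin.sum_univ_two, hZ0, hZ1, hp0, hp1]
  have hI : mutualInfo p W = -lam * d - ∑ j, p j * Real.log (partitionFn ρ Q lam j) := by
    have hlog : ∀ j k, Real.log (W j k / outputDist p W k) =
        -lam * ρ j k - Real.log (partitionFn ρ Q lam j) := by
      intro j k
      have : W j k / outputDist p W k = Real.exp (-lam * ρ j k) / partitionFn ρ Q lam j := by
        have := (hQn k).ne'
        rw [hout, hW]
        field_simp
      rw [this, Real.log_div (Real.exp_pos _).ne' (hZ j).ne', Real.log_exp]
    have hrow : ∀ j, ∑ k, p j * W j k = p j := fun j => by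
      rw [← Finset.mul_sum, (hch j).2, mul_one]
    rw [mutualInfo, ← hD, expectedDistortion, Finset.mul_sum, ← Finset.sum_sub_distrib]
    refine Finset.sum_congr rfl fun j _ => ?_
    rw [← hrow j, Finset.sum_mul, Finset.mul_sum, ← Finset.sum_sub_distrib]
    refine Finset.sum_congr rfl fun k _ => ?_
    rw [hlog, hrow]
    ring
  have hlow : ∀ d' : ℝ, ∀ x ∈ mutualInfo p '' admissible p d' ρ,
      -lam * d' - ∑ j, p j * Real.log (partitionFn ρ Q lam j) ≤ x := by
    rintro d' x ⟨V, hV, rfl⟩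
    exact dual_le_mutualInfo hp hlam.le hZ (fun k => (hkkt k).le) hV
  have hopt : mutualInfo p W = rate p d ρ := by
    refine le_antisymm ?_ (csInf_le ⟨_, hlow d⟩ ⟨W, hadm, rfl⟩)
    exact le_csInf ⟨_, W, hadm, rfl⟩ fun x hx => hI.trans_le (hlow d x hx)
  refine ⟨W, ⟨hadm, hopt, ?_, ?_, ?_, ?_, ?_, ?_⟩, ?_⟩
  · intro j k
    rw [hout]
  · intro k _
    rw [hout]
    exact hkkt k
  · intro k _
    rw [hout]
    exact (hkkt k).le
  · rw [hD, sub_self, mul_zero]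
  · rw [hout, ← hopt, hI]
  -- The dual bound holds at every `d'` with the same `lam` and `Z`. The identity channel makes the
  -- set nonempty, so the infimum is not the default `0`.
  · intro d' hd'
    refine le_csInf ?_ fun x hx => le_trans ?_ (hlow d' x hx)
    · refine ⟨_, fun j k => if k = j then 1 else 0, ⟨fun j => ⟨fun k => ?_, ?_⟩, ?_⟩, rfl⟩
      · dsimp only
        split_ifs <;> norm_num
      · simp
      · simp only [expectedDistortion, Fin.sum_univ_two, hρ00, hρ01, hρ10, hρ11]
        simpa using hd'.le
    · rw [← hopt, hI]
      linarith
  · rw [← hopt, hI, hsumZ, hrate]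

lemma rank_binaryHamming {ρmax lam : ℝ} (hρ : 0 < ρmax) (hlam : 0 < lam) :
    (Matrix.of fun j k => Real.exp (-lam * binaryHamming ρmax j k)).rank = 2 := by
  have hdet : (Matrix.of fun j k => Real.exp (-lam * binaryHamming ρmax j k)).det ≠ 0 := by
    rw [Matrix.det_fin_two]
    have h : Real.exp (-lam * ρmax) < 1 := by
      rw [Real.exp_lt_one_iff]
      nlinarith
    have h' := Real.exp_pos (-lam * ρmax)
    have : (1 : ℝ) - Real.exp (-lam * ρmax) * Real.exp (-lam * ρmax) ≠ 0 := by nlinarith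
    simpa [binaryHamming] using this
  have := Matrix.rank_of_isUnit _ ((Matrix.isUnit_iff_isUnit_det _).2 (isUnit_iff_ne_zero.2 hdet))
  simpa using this

/-- Regularity must hold for every Lagrange solution, so the explicit one serves only for existence
and for comparison. -/
lemma bernoulliLaw_mem_regularSources {ρmax d q : ℝ} (hd : 0 < d) (hdq : d < q * ρmax)
    (hρ : 0 < ρmax) (hq : q < 1 / 2) :
    bernoulliLaw q ∈ regularSources d (binaryHamming ρmax) := by
  have hq0 : 0 < q := by by_contra! h; nlinarith
  obtain ⟨W₀, hW₀, -⟩ := exists_isLagrangeSolution hd hdq hρ hq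
  refine ⟨bernoulliLaw_mem hq0.le (by linarith), ⟨W₀, _, hW₀⟩, fun W lam h => ?_⟩
  -- The explicit solution at the midpoint of `d` and `q * ρmax` has positive slope, so the rate is
  -- strictly smaller there than at `d`; a subgradient at `d` must then be negative.
  have hlam : 0 < lam := by
    obtain ⟨V, hV, -⟩ := exists_isLagrangeSolution (d := (d + q * ρmax) / 2) (q := q) (by linarith)
      (by linarith) hρ hq
    have hpos := binaryMultiplier_pos (ρmax := ρmax) (d := (d + q * ρmax) / 2) (by linarith)
      (by nlinarith)
    have h1 := hV.subgradient d hd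
    have h2 := h.subgradient ((d + q * ρmax) / 2) (by linarith)
    by_contra! hneg
    nlinarith
  have hps : ∀ j, 0 < bernoulliLaw q j := by
    rw [Fin.forall_fin_two]
    simp only [bernoulliLaw, if_true, one_ne_zero, if_false]
    constructor <;> linarith
  refine ⟨by simpa using rank_binaryHamming hρ hlam, ⟨hps, fun k => ?_⟩, hlam⟩
  have hnn : ∀ j k, 0 ≤ bernoulliLaw q j * W j k := fun j k =>
    mul_nonneg (hps j).le ((h.mem.1 j).1 k)
  -- If an output letter were unused, the output would be constant, with distortion `q * ρmax` or
  -- `(1 - q) * ρmax`, both above `d`.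
  refine (Finset.sum_nonneg fun j _ => hnn j k).lt_of_ne' fun hzero => ?_
  have hz := (Finset.sum_eq_zero_iff_of_nonneg fun j _ => hnn j k).1 hzero
  have hz' : ∀ j, W j k = 0 := fun j =>
    (mul_eq_zero.1 (hz j (Finset.mem_univ j))).resolve_left (hps j).ne'
  have hD := h.mem.2
  have hr0 := (h.mem.1 0).2
  have hr1 := (h.mem.1 1).2
  rw [Fin.sum_univ_two] at hr0 hr1
  simp only [expectedDistortion, Fin.sum_univ_two, bernoulliLaw, binaryHamming] at hD
  have ha := hz' 0
  have hb := hz' 1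
  fin_cases k <;> simp_all <;> nlinarith

end RateDistortion

/-! ### Passage to the boundary source. -/

theorem lemma11 (ρmax d : ℝ) (hd_pos : 0 < d) (hd_lt : d < ρmax / 2) :
    (0 : EReal) < Filter.liminf
      (fun n : ℕ =>
        ⨅ C : RateDistortion.SemifaithfulCode (RateDistortion.binaryHamming ρmax) d n,
          ⨆ p ∈ RateDistortion.regularSources d (RateDistortion.binaryHamming ρmax),
            ((C.redundancy p * Real.sqrt (n : ℝ) : ℝ) : EReal))
      Filter.atTop := by
  have hρ : 0 < ρmax := by linarith
  have h0 : 0 < d / ρmax := div_pos hd_pos hρ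
  have h2 : d / ρmax < 1 / 2 := by rw [div_lt_iff₀ hρ]; linarith
  obtain ⟨c, hc, hev⟩ :=
    RateDistortion.SemifaithfulCode.eventually_le_expectedLength hρ hd_pos hd_lt
  have hl2 : 0 < Real.log 2 := Real.log_pos one_lt_two
  have hpos : (0 : EReal) < ((Real.log 2 * c : ℝ) : EReal) := by
    exact_mod_cast mul_pos hl2 hc
  refine hpos.trans_le (Filter.le_liminf_of_le (by isBoundedDefault) ?_)
  filter_upwards [hev, Filter.eventually_gt_atTop 0] with n hn hn0
  refine le_iInf fun C => ?_
  have hn0' : (0 : ℝ) < n := by exact_mod_cast hn0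
  -- Stated with `binaryRate` rather than `rate`: continuity at `d / ρmax` is then elementary, and
  -- the two agree for the `q` used in the limit.
  let F : ℝ → ℝ := fun q => (Real.log 2 / (n : ℝ) * C.expectedLength (RateDistortion.bernoulliLaw q) -
    RateDistortion.binaryRate ρmax d q) * Real.sqrt (n : ℝ)
  have hF : ContinuousAt F (d / ρmax) := by
    have hlaw : ∀ j, Continuous fun q => RateDistortion.bernoulliLaw q j := by
      intro j
      unfold RateDistortion.bernoulliLaw
      split_ifs <;> fun_prop
    have hE : Continuous fun q => C.expectedLength (RateDistortion.bernoulliLaw q) := by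
      unfold RateDistortion.SemifaithfulCode.expectedLength
      fun_prop
    have hR : ContinuousAt (RateDistortion.binaryRate ρmax d) (d / ρmax) := by
      unfold RateDistortion.binaryRate
      have h1 : (1 - d / ρmax) ≠ 0 := by linarith
      fun_prop (disch := exact div_ne_zero (by linarith) h1)
    exact ((hE.continuousAt.const_mul _).sub hR).mul_const _
  have hself : Real.log 2 * c ≤ F (d / ρmax) := by
    have hs := Real.mul_self_sqrt hn0'.le
    calc Real.log 2 * c = Real.log 2 / n * (c * √n) * √n := by
          rw [mul_assoc, mul_assoc, hs]
          field_simp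
      _ ≤ Real.log 2 / n * C.expectedLength (RateDistortion.bernoulliLaw (d / ρmax)) * √n := by
          have := hn C
          gcongr
      _ = F (d / ρmax) := by
          simp only [F, RateDistortion.binaryRate_self hd_pos hd_lt, sub_zero]
  refine le_trans (EReal.coe_le_coe_iff.2 hself) ?_
  have hlim : Filter.Tendsto (fun q => ((F q : ℝ) : EReal)) (nhdsWithin (d / ρmax) (Set.Ioi (d / ρmax)))
      (nhds ((F (d / ρmax) : ℝ) : EReal)) :=
    (continuous_coe_real_ereal.tendsto _).comp (hF.tendsto.mono_left nhdsWithin_le_nhds)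
  refine le_of_tendsto hlim ?_
  filter_upwards [Ioo_mem_nhdsGT h2] with q hq
  have hdq : d < q * ρmax := by rw [← div_lt_iff₀ hρ]; exact hq.1
  obtain ⟨W, -, hrate⟩ := RateDistortion.exists_isLagrangeSolution hd_pos hdq hρ hq.2
  refine le_iSup₂_of_le _ (RateDistortion.bernoulliLaw_mem_regularSources hd_pos hdq hρ hq.2) ?_
  rw [RateDistortion.SemifaithfulCode.redundancy, hrate]
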